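/- **Theorem (quantum Frank–Wolfe over the $\ell_1$-ball).** Let $d\ge 1$, $\mathcal D=\{x\in\mathbb R^d:\|x\|_1\le 1\}$, and let $f:\mathbb R^d\to\mathbb R$ be convex, differentiable and $L$-smooth, i.e. $\|\nabla f(x)-\nabla f(y)\|_2\le L\|x-y\|_2$ for all $x,y\in\mathbb R^d$. Let $$C_f=\sup_{x,s\in\mathcal D,\ \beta\in(0,1],\ y=x+\beta(s-x)}\frac{2}{\beta^2}\bigl(f(y)-f(x)-\langle y-x,\nabla f(x)\rangle\bigr)$$ be the curvature of $f$ over $\mathcal D$, and assume $C_f>0$. The function $f$ is accessed only through the unitary $U_f:|x\rangle|a\rangle\mapsto|x\rangle|a+f(x)\rangle$, whose registers hold points of $\mathbb R^d$ and real numbers exactly. For $\varepsilon>0$ and $0<p<1$ put $T=\max\{1,\lceil 4C_f/\varepsilon-2\rceil\}$, $\gamma_t=\frac{2}{t+2}$ and $\sigma_t=\frac{C_f}{\sqrt d\,L\,(t+2)}$ for $t=0,1,\dots,T-1$. The quantum Frank–Wolfe algorithm starts at an arbitrary $x^{(0)}\in\mathcal D$. In round $t=0,\dots,T-1$ it uses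 a quantum maximum-finding subroutine which, for each function $f$, with probability at least $1-p/T$, returns an index $i_t$ maximizing $|g_i|$ over $i$, where $g_i=\bigl(f(x^{(t)}+\sigma_te_i)-f(x^{(t)})\bigr)/\sigma_t$ is the forward difference, together with a sign $s_t\in\{-1,1\}$ with $s_tg_{i_t}=|g_{i_t}|$; it then sets $x^{(t+1)}=(1-\gamma_t)x^{(t)}+\gamma_t\,(-s_te_{i_t})$. There are an absolute constant $C>0$ and, for each $d$, such a subroutine (a quantum query algorithm that does not depend on $f$ except through $U_f$ and the parameters $\sigma_t$, $p/T$, $x^{(t)}$) such that, for all $f,L,\varepsilon,p,x^{(0)}$ as above and every minimizer $x^*$ of $f$ over $\mathcal D$, after $T$ rounds $$x^{(T)}\in\mathcal D\quad\text{and}\quad f(x^{(T)})-f(x^*)\le\varepsilon\qquad\text{with probability at least }1-p,$$ and each round makes at most $$C\sqrt d\,\Bigl(1+\log\frac{\max\{1,C_f/\varepsilon\}}{p}\Bigr)$$ calls to $U_f$; this is $O\bigl(\sqrt d\,\log\frac{C_f}{p\varepsilon}\bigr)$ when $\varepsilon\le C_f$ and $p\le\tfrac12$. -/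

import Mathlib

open scoped ENNReal

noncomputable section

namespace QFW

/-! ### The optimisation problem -/

/-- `ℝ^d` with the Euclidean norm and inner product. -/
abbrev Vec (d : ℕ) : Type := EuclideanSpace ℝ (Fin d)

/-- The unit `ℓ₁`-ball of `ℝ^d`. -/
def l1Ball (d : ℕ) : Set (Vec d) := {x | ∑ i, |x i| ≤ 1}

/-- `f` is differentiable and its gradient is `L`-Lipschitz for the Euclidean norm. -/
def IsSmoothWith {d : ℕ} (L : ℝ) (f : Vec d → ℝ) : Prop :=
  Differentiable ℝ f ∧ ∀ x y : Vec d, ‖gradient f x - gradient f y‖ ≤ L * ‖x - y‖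

/-- The curvature `C_f` of `f` over a set `D`: the supremum, over `x, s ∈ D` and `β ∈ (0, 1]`, of
`(2 / β²) (f y - f x - ⟨y - x, ∇ f x⟩)` with `y = x + β (s - x)`. -/
def curvature {d : ℕ} (D : Set (Vec d)) (f : Vec d → ℝ) : ℝ :=
  sSup {c : ℝ | ∃ x ∈ D, ∃ s ∈ D, ∃ β ∈ Set.Ioc (0 : ℝ) 1,
    c = 2 / β ^ 2 * (f (x + β • (s - x)) - f x
      - inner ℝ ((x + β • (s - x)) - x) (gradient f x))}

/-- The forward difference `(f (x + σ eᵢ) - f x) / σ`. -/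
def forwardDiff {d : ℕ} (f : Vec d → ℝ) (σ : ℝ) (x : Vec d) (i : Fin d) : ℝ :=
  (f (x + σ • EuclideanSpace.single i (1 : ℝ)) - f x) / σ

/-! ### Quantum computation with a function value oracle -/

/-- The Hilbert space whose computational basis is indexed by `B`. -/
abbrev Hilb (B : Type) : Type := lp (fun _ : B => ℂ) 2

/-- The computational basis vector `|b⟩`. -/
def ket {B : Type} (b : B) : Hilb B :=
  haveI := Classical.decEq B
  lp.single 2 b (1 : ℂ)

theorem norm_ket {B : Type} (b : B) : ‖ket b‖ = 1 := by
  classical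
  unfold ket
  rw [lp.norm_single (by norm_num)]
  simp

theorem hasSum_sq {B : Type} (ψ : Hilb B) : HasSum (fun b => ‖ψ b‖ ^ 2) (‖ψ‖ ^ 2) := by
  have h := lp.hasSum_norm (p := 2) (by norm_num) ψ
  simpa using h

theorem memℓp_comp {B : Type} (e : B ≃ B) (ψ : Hilb B) :
    Memℓp (fun b => ψ (e b) : (b : B) → (fun _ : B => ℂ) b) 2 := by
  apply memℓp_gen
  have h := (lp.memℓp ψ).summable (by norm_num)
  exact e.summable_iff.mpr h

/-- The unitary that permutes the computational basis by `e`, that is `|b⟩ ↦ |e b⟩`. -/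
def permUnitary {B : Type} (e : B ≃ B) : Hilb B ≃ₗᵢ[ℂ] Hilb B where
  toFun ψ := ⟨fun b => ψ (e.symm b), memℓp_comp e.symm ψ⟩
  invFun ψ := ⟨fun b => ψ (e b), memℓp_comp e ψ⟩
  map_add' ψ φ := by ext b; rfl
  map_smul' c ψ := by ext b; rfl
  left_inv ψ := by ext b; simp
  right_inv ψ := by ext b; simp
  norm_map' ψ := by
    have h1 := hasSum_sq ψ
    have h2 := hasSum_sq (⟨fun b => ψ (e.symm b), memℓp_comp e.symm ψ⟩ : Hilb B)
    have h3 : HasSum (fun b => ‖ψ (e.symm b)‖ ^ 2) (‖ψ‖ ^ 2) :=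
      (e.symm.hasSum_iff (f := fun b => ‖ψ b‖ ^ 2)).mpr h1
    exact (sq_eq_sq₀ (norm_nonneg _) (norm_nonneg _)).mp (h2.unique h3)

/-- Basis labels `(x, a, w)`: a query register holding a point `x ∈ ℝ^d`, an answer register
holding a real number `a`, and a workspace with basis `W`. -/
abbrev Label (d : ℕ) (W : Type) : Type := Vec d × ℝ × W

/-- The function value oracle `U_f : |x⟩|a⟩ ↦ |x⟩|a + f x⟩`, acting trivially on the workspace. -/
def oracle {d : ℕ} (W : Type) (f : Vec d → ℝ) : Hilb (Label d W) ≃ₗᵢ[ℂ] Hilb (Label d W) :=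
  permUnitary
    { toFun := fun b => (b.1, b.2.1 + f b.1, b.2.2)
      invFun := fun b => (b.1, b.2.1 - f b.1, b.2.2)
      left_inv := fun b => by simp
      right_inv := fun b => by simp }

/-- A unitary query circuit `Vₙ U_f Vₙ₋₁ ⋯ V₁ U_f V₀`: `first` is `V₀` and `rest` is
`[V₁, …, Vₙ]`. The unitaries `Vₖ` cannot depend on `f`. -/
structure Circuit (d : ℕ) (W : Type) where
  first : Hilb (Label d W) ≃ₗᵢ[ℂ] Hilb (Label d W)
  rest : List (Hilb (Label d W) ≃ₗᵢ[ℂ] Hilb (Label d W))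

/-- The number of applications of the oracle in a circuit. -/
def Circuit.queries {d : ℕ} {W : Type} (c : Circuit d W) : ℕ := c.rest.length

/-- The final state of the circuit on the initial basis state `|b⟩`. -/
def Circuit.state {d : ℕ} {W : Type} (c : Circuit d W) (f : Vec d → ℝ) (b : Label d W) :
    Hilb (Label d W) :=
  c.rest.foldl (fun ψ V => V (oracle W f ψ)) (c.first (ket b))

theorem Circuit.norm_state {d : ℕ} {W : Type} (c : Circuit d W) (f : Vec d → ℝ)
    (b : Label d W) : ‖c.state f b‖ = 1 := by
  have key : ∀ (l : List (Hilb (Label d W) ≃ₗᵢ[ℂ] Hilb (Label d W))) (ψ : Hilb (Label d W)),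
      ‖ψ‖ = 1 → ‖l.foldl (fun ψ V => V (oracle W f ψ)) ψ‖ = 1 := by
    intro l
    induction l with
    | nil => intro ψ h; simpa using h
    | cons V l ih =>
      intro ψ h
      rw [List.foldl_cons]
      apply ih
      rw [LinearIsometryEquiv.norm_map, LinearIsometryEquiv.norm_map, h]
  apply key
  rw [LinearIsometryEquiv.norm_map, norm_ket]

/-- Measuring a unit vector in the computational basis: outcome `b` has probability `|ψ b|²`. -/
def measure {B : Type} (ψ : Hilb B) (h : ‖ψ‖ = 1) : PMF B :=
  ⟨fun b => ENNReal.ofReal (‖ψ b‖ ^ 2), by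
    have hs := hasSum_sq ψ
    rw [h, one_pow] at hs
    have ht : ∑' b, ENNReal.ofReal (‖ψ b‖ ^ 2) = 1 := by
      rw [← ENNReal.ofReal_tsum_of_nonneg (fun b => sq_nonneg _) hs.summable, hs.tsum_eq,
        ENNReal.ofReal_one]
    exact ht ▸ ENNReal.summable.hasSum⟩

/-- Quantum query algorithms with classical control: either return a value, or run a query circuit
on a computational basis state, measure all registers, and continue according to the outcome. -/
inductive QAlg (d : ℕ) (α : Type) : Type 1
  | ret (a : α) : QAlg d α
  | run (W : Type) (c : Circuit d W) (b : Label d W) (next : Label d W → QAlg d α) : QAlg d α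

/-- The output distribution of a quantum query algorithm when the oracle is `U_f`. -/
def QAlg.output {d : ℕ} {α : Type} (f : Vec d → ℝ) : QAlg d α → PMF α
  | .ret a => PMF.pure a
  | .run _ c b next =>
      (measure (c.state f b) (c.norm_state f b)).bind fun b' => (next b').output f

/-- The algorithm applies the oracle at most `n` times, whatever the measurement outcomes. -/
def QAlg.QueriesAtMost {d : ℕ} {α : Type} : QAlg d α → ℕ → Prop
  | .ret _, _ => True
  | .run _ c _ next, n => ∃ m : ℕ, c.queries + m ≤ n ∧ ∀ b', (next b').QueriesAtMost m

/-! ### The quantum Frank-Wolfe algorithm -/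

/-- A coordinate `i` with a sign `±1`. -/
abbrev SignedIndex (d : ℕ) : Type := Fin d × ℤˣ

/-- The Frank-Wolfe atom `-s eᵢ` selected by the coordinate `i` and the sign `s`. -/
def atom {d : ℕ} (o : SignedIndex d) : Vec d :=
  (-((o.2 : ℤ) : ℝ)) • EuclideanSpace.single o.1 (1 : ℝ)

/-- A maximum finding subroutine, with parameters `σ` (step size), `δ` (failure probability) and
`x` (current point). -/
abbrev Finder (d : ℕ) : Type 1 := ℝ → ℝ → Vec d → QAlg d (SignedIndex d)

/-- `A σ δ x` finds, given only the oracle of an arbitrary `f`, with probability at least `1 - δ`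
a coordinate `i` at which the forward difference `g` of `f` at `x` has the largest absolute value,
together with a sign of `gᵢ`. -/
def Finder.FindsMaxAbs {d : ℕ} (A : Finder d) : Prop :=
  ∀ (f : Vec d → ℝ) (σ δ : ℝ) (x : Vec d), 0 < σ → 0 < δ → δ < 1 →
    ENNReal.ofReal (1 - δ) ≤ ((A σ δ x).output f).toOuterMeasure
      {o | ∀ j, |forwardDiff f σ x j| ≤ ((o.2 : ℤ) : ℝ) * forwardDiff f σ x o.1}

/-- The law of the iterate `x^(t)` of the quantum Frank-Wolfe algorithm started at `x₀`, with
difference steps `σ t` and failure probability `δ` of the subroutine in each round: round `t` runs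
the subroutine at `x^(t)`, and sets `x^(t+1) = (1 - γ_t) x^(t) + γ_t s`, where `γ_t = 2 / (t + 2)`
and `s` is the atom that the subroutine returned. -/
def quantumFW {d : ℕ} (A : Finder d) (f : Vec d → ℝ) (σ : ℕ → ℝ) (δ : ℝ) (x₀ : Vec d) :
    ℕ → PMF (Vec d)
  | 0 => PMF.pure x₀
  | t + 1 => (quantumFW A f σ δ x₀ t).bind fun x =>
      ((A (σ t) δ x).output f).map fun o =>
        (1 - 2 / ((t : ℝ) + 2)) • x + (2 / ((t : ℝ) + 2)) • atom o

/-- The number of rounds: `4 C_f / ε - 2`, rounded up, and at least one. -/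
def rounds (Cf ε : ℝ) : ℕ := max 1 ⌈4 * Cf / ε - 2⌉₊

/-- The difference step `σ_t = C_f / (√d L (t + 2))`. -/
def stepSize (d : ℕ) (Cf L : ℝ) (t : ℕ) : ℝ := Cf / (Real.sqrt d * L * ((t : ℝ) + 2))

end QFW

end

noncomputable section

namespace QFW

/-! ### Kets, superpositions and phase flips -/

section Hilb

variable {B ι : Type}

/-! Frank–Wolfe tolerates inexact linear minimisation. Over the ℓ₁-ball, ⟨·, ∇f x⟩ is minimised at a
vertex -s eᵢ with |∂ᵢf| maximal. Smoothness puts each forward difference within Lσ/2 of the partial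
derivative, so the atom of a maximal difference loses at most Lσ. The choice of σ_t keeps this loss
below C_f/(t+2); convexity and the definition of curvature then propagate the gap bound 4C_f/(t+2)
(`frankWolfe_step`). A union bound over T rounds, each failing with probability at most p/T, gives
p.

The maximum is sought among the N = 2d signed differences, so the sign comes with the index. Phase k
starts at an item with at most N/9^k strictly better ones (its rank) and aims at rank at most
N/9^(k+1), by Grover search with 2j+1 = 3^k for something better than the current item. Each better
item is measured with probability at least 9^k/(4N), and while the goal is unmet at least N/9^(k+1)
items would meet it, so one search succeeds with probability at least 1/36 (`groverLaw_compl_le`).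
Once N/9^k < 1 the rank is 0.

A search of phase k, with its verification, costs 3^k queries. Repeating it b times plus the number
of phases left bounds the total failure by a geometric series, at most 35(35/36)^b
(`sum_pow_repetitions_le`), while the late phases, repeated least, dominate the cost: O(√d (1 + b)),
with no further factor depending on d (`climbCost_schedule`). -/

open Classical in
theorem ket_apply (b b' : B) : ket b b' = if b' = b then 1 else 0 := by
  unfold ket
  rw [lp.single_apply]
  by_cases h : b' = b
  · subst h; simp
  · simp [h]

theorem inner_ket (b : B) (ψ : Hilb B) : inner ℂ (ket b) ψ = ψ b := by
  classical
  unfold ket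
  rw [lp.inner_single_left]
  simp

theorem permUnitary_apply (e : B ≃ B) (ψ : Hilb B) (b : B) :
    permUnitary e ψ b = ψ (e.symm b) := rfl

theorem permUnitary_ket (e : B ≃ B) (b : B) : permUnitary e (ket b) = ket (e b) := by
  ext b'
  rw [permUnitary_apply, ket_apply, ket_apply]
  by_cases h : b' = e b
  · rw [if_pos h, if_pos (e.symm_apply_eq.mpr h)]
  · rw [if_neg h, if_neg (mt e.symm_apply_eq.mp h)]

theorem measure_congr {ψ φ : Hilb B} (h : ψ = φ) (hψ : ‖ψ‖ = 1) (hφ : ‖φ‖ = 1) :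
    measure ψ hψ = measure φ hφ := by
  subst h; rfl

theorem measure_apply (ψ : Hilb B) (h : ‖ψ‖ = 1) (b : B) :
    measure ψ h b = ENNReal.ofReal (‖ψ b‖ ^ 2) := rfl

theorem measure_ket (b : B) : measure (ket b) (norm_ket b) = PMF.pure b := by
  ext b'
  rw [measure_apply, ket_apply, PMF.pure_apply]
  split_ifs <;> simp

open Classical in
theorem memℓp_flip (s : Set B) (ψ : Hilb B) :
    Memℓp (fun b => if b ∈ s then -ψ b else ψ b : (b : B) → (fun _ : B => ℂ) b) 2 := by
  apply memℓp_gen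
  refine ((lp.memℓp ψ).summable (by norm_num)).congr fun b => ?_
  split_ifs <;> simp

open Classical in
/-- The diagonal unitary with eigenvalue `-1` on the kets of `s` and `1` on the others. -/
def phaseFlip (s : Set B) : Hilb B ≃ₗᵢ[ℂ] Hilb B where
  toFun ψ := ⟨fun b => if b ∈ s then -ψ b else ψ b, memℓp_flip s ψ⟩
  invFun ψ := ⟨fun b => if b ∈ s then -ψ b else ψ b, memℓp_flip s ψ⟩
  map_add' ψ φ := by
    ext b
    change (if b ∈ s then -(ψ b + φ b) else ψ b + φ b) =
      (if b ∈ s then -ψ b else ψ b) + (if b ∈ s then -φ b else φ b)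
    split_ifs <;> ring
  map_smul' c ψ := by
    ext b
    change (if b ∈ s then -(c * ψ b) else c * ψ b) = c * (if b ∈ s then -ψ b else ψ b)
    split_ifs <;> ring
  left_inv ψ := by
    ext b
    change (if b ∈ s then -(if b ∈ s then -ψ b else ψ b) else (if b ∈ s then -ψ b else ψ b)) = ψ b
    split_ifs <;> simp
  right_inv ψ := by
    ext b
    change (if b ∈ s then -(if b ∈ s then -ψ b else ψ b) else (if b ∈ s then -ψ b else ψ b)) = ψ b
    split_ifs <;> simp
  norm_map' ψ := by
    have h1 := hasSum_sq ψ
    have h2 := hasSum_sq (⟨fun b => if b ∈ s then -ψ b else ψ b, memℓp_flip s ψ⟩ : Hilb B)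
    have h3 : (fun b => ‖if b ∈ s then -ψ b else ψ b‖ ^ 2) = fun b => ‖ψ b‖ ^ 2 := by
      funext b; split_ifs <;> simp
    refine (sq_eq_sq₀ (norm_nonneg _) (norm_nonneg _)).mp (h2.unique ?_)
    change HasSum (fun b => ‖if b ∈ s then -ψ b else ψ b‖ ^ 2) (‖ψ‖ ^ 2)
    rwa [h3]

open Classical in
theorem phaseFlip_ket (s : Set B) (b : B) :
    phaseFlip s (ket b) = (if b ∈ s then (-1 : ℂ) else 1) • ket b := by
  ext b'
  change (if b' ∈ s then -ket b b' else ket b b') = (if b ∈ s then (-1 : ℂ) else 1) * ket b b'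
  rw [ket_apply]
  by_cases h : b' = b
  · subst h; split_ifs <;> simp
  · simp [h]

variable [Fintype ι]

/-- The vector `∑ᵢ cᵢ |bᵢ⟩`. -/
def superpose (b : ι → B) (c : ι → ℂ) : Hilb B := ∑ i, c i • ket (b i)

theorem superpose_apply {b : ι → B} (hb : b.Injective) (c : ι → ℂ) (i : ι) :
    superpose b c (b i) = c i := by
  classical
  rw [← inner_ket, superpose, inner_sum]
  simp only [inner_smul_right, inner_ket, ket_apply, hb.eq_iff]
  simp

theorem superpose_apply_of_notMem {b : ι → B} {b₀ : B} (h : ∀ i, b₀ ≠ b i) (c : ι → ℂ) :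
    superpose b c b₀ = 0 := by
  rw [← inner_ket, superpose, inner_sum]
  simp [inner_smul_right, inner_ket, ket_apply, h]

theorem inner_superpose_one {b : ι → B} (hb : b.Injective) (c : ι → ℂ) :
    inner ℂ (superpose b fun _ => 1) (superpose b c) = ∑ i, c i := by
  rw [superpose, sum_inner]
  simp [inner_ket, superpose_apply hb]

theorem permUnitary_superpose (e : B ≃ B) (b : ι → B) (c : ι → ℂ) :
    permUnitary e (superpose b c) = superpose (fun i => e (b i)) c := by
  simp [superpose, map_sum, permUnitary_ket]

open Classical in
theorem phaseFlip_superpose (s : Set B) (b : ι → B) (c : ι → ℂ) :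
    phaseFlip s (superpose b c) = superpose b fun i => if b i ∈ s then -c i else c i := by
  simp only [superpose, map_sum, map_smul, phaseFlip_ket, smul_smul]
  refine Finset.sum_congr rfl fun i _ => ?_
  split_ifs <;> simp

/-- The reflection about the uniform superposition of the kets `|bᵢ⟩`. -/
def diffusion (b : ι → B) : Hilb B ≃ₗᵢ[ℂ] Hilb B :=
  (ℂ ∙ superpose b fun _ => (1 : ℂ)).reflection

theorem reflection_singleton_eq (u ψ : Hilb B) :
    (ℂ ∙ u).reflection ψ = (2 * (inner ℂ u ψ / inner ℂ u u)) • u - ψ := by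
  rw [Submodule.reflection_singleton_apply, inner_self_eq_norm_sq_to_K (𝕜 := ℂ), two_mul, add_smul,
    two_nsmul]

/-- Inversion about the mean: injectivity makes the kets orthonormal, so the quotient of inner
products in the reflection is the average amplitude. -/
theorem diffusion_superpose {b : ι → B} (hb : b.Injective) (c : ι → ℂ) :
    diffusion b (superpose b c) =
      superpose b fun i => 2 * ((∑ j, c j) / Fintype.card ι) - c i := by
  rw [diffusion, reflection_singleton_eq, inner_superpose_one hb, inner_superpose_one hb]
  simp [superpose, sub_smul, Finset.sum_sub_distrib, Finset.smul_sum]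

/-- A unitary that maps `|b₀⟩` to the uniform superposition of the kets `|bᵢ⟩`, for `b₀` not among
the `bᵢ`. -/
def prepare (b₀ : B) (b : ι → B) : Hilb B ≃ₗᵢ[ℂ] Hilb B :=
  (ℂ ∙ (((Real.sqrt (Fintype.card ι) : ℝ) : ℂ) • ket b₀ + superpose b fun _ => (1 : ℂ))).reflection

/-- √N|b₀⟩ and ∑|bᵢ⟩ are orthogonal of equal norm, so the reflection about their sum exchanges them.
-/
theorem prepare_ket [Nonempty ι] {b₀ : B} {b : ι → B} (hb : b.Injective) (h : ∀ i, b₀ ≠ b i) :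
    prepare b₀ b (ket b₀) =
      superpose b fun _ => (((Real.sqrt (Fintype.card ι))⁻¹ : ℝ) : ℂ) := by
  set r : ℝ := Real.sqrt (Fintype.card ι) with hr
  set u : Hilb B := superpose b fun _ => (1 : ℂ) with hu
  have hr2 : ((r : ℝ) : ℂ) ^ 2 = Fintype.card ι := by
    rw [← Complex.ofReal_pow, hr, Real.sq_sqrt (by positivity)]; simp
  have hr0 : (r : ℂ) ≠ 0 := by
    rw [Ne, Complex.ofReal_eq_zero, hr]
    have : 0 < Fintype.card ι := Fintype.card_pos
    positivity
  have h1 : inner ℂ (ket b₀) u = 0 := by rw [inner_ket, hu, superpose_apply_of_notMem h]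
  have h2 : inner ℂ u (ket b₀) = 0 := by rw [← inner_conj_symm, h1]; simp
  have h3 : inner ℂ (ket b₀) (ket b₀) = 1 := by rw [inner_ket, ket_apply]; simp
  have h4 : inner ℂ u u = (r : ℂ) ^ 2 := by
    rw [hu, inner_superpose_one hb, hr2]; simp
  have h5 : inner ℂ ((r : ℂ) • ket b₀ + u) ((r : ℂ) • ket b₀ + u) = 2 * (r : ℂ) ^ 2 := by
    simp only [inner_add_left, inner_add_right, inner_smul_left, inner_smul_right, h1, h2, h3, h4,
      Complex.conj_ofReal]
    ring
  have h6 : inner ℂ ((r : ℂ) • ket b₀ + u) (ket b₀) = r := by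
    simp only [inner_add_left, inner_smul_left, h2, h3, Complex.conj_ofReal]
    ring
  have h7 : superpose b (fun _ => ((r⁻¹ : ℝ) : ℂ)) = ((r : ℂ)⁻¹) • u := by
    simp [hu, superpose, Finset.smul_sum]
  have h8 : 2 * ((r : ℂ) / (2 * (r : ℂ) ^ 2)) = (r : ℂ)⁻¹ := by field_simp
  rw [prepare, reflection_singleton_eq, h6, h5, h7, h8, smul_add, smul_smul, inv_mul_cancel₀ hr0,
    one_smul, add_sub_cancel_left]

end Hilb

/-! ### Amplitude recursion -/

/-- The amplitudes of marked and unmarked items, relative to the uniform amplitude, after `j`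
Grover iterations, when `l` is the fraction of marked items. -/
def groverAmp (l : ℝ) : ℕ → ℝ × ℝ
  | 0 => (1, 1)
  | j + 1 =>
    let a := (groverAmp l j).1
    let b := (groverAmp l j).2
    (2 * ((1 - l) * b - l * a) + a, 2 * ((1 - l) * b - l * a) - b)

/-- A substitute for the closed form sin((2j+1)θ)/sin θ. While (2j+1)²l ≤ 1, the unmarked amplitude
stays at least 1/2 and each iteration adds between 1 and 2 to the marked one. All four bounds are
needed to close the induction. -/
theorem groverAmp_bounds {l : ℝ} (hl : 0 ≤ l) (j : ℕ) (h : (2 * (j : ℝ) + 1) ^ 2 * l ≤ 1) :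
    (2 * (j : ℝ) + 1) / 2 ≤ (groverAmp l j).1 ∧ (groverAmp l j).1 ≤ 2 * j + 1 ∧
      1 - 2 * l * (j * (j + 1)) ≤ (groverAmp l j).2 ∧ (groverAmp l j).2 ≤ 1 := by
  induction j with
  | zero => norm_num [groverAmp]
  | succ j ih =>
    push_cast at h ⊢
    have hj : (0 : ℝ) ≤ j := Nat.cast_nonneg j
    have hq : (2 * (j : ℝ) + 1) ^ 2 * l ≤ 1 := by
      refine le_trans (mul_le_mul_of_nonneg_right ?_ hl) h
      nlinarith
    obtain ⟨h1, h2, h3, h4⟩ := ih hq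
    simp only [groverAmp]
    set a := (groverAmp l j).1
    set b := (groverAmp l j).2
    have hab : 0 ≤ a + b := by nlinarith
    have hle : l * (a + b) ≤ l * (2 * j + 2) := mul_le_mul_of_nonneg_left (by linarith) hl
    have hlab : 0 ≤ l * (a + b) := mul_nonneg hl hab
    refine ⟨?_, ?_, ?_, ?_⟩ <;> nlinarith

/-! ### Classical evaluation and Grover circuits -/

section Circuits

variable {d : ℕ}

/-- Query the oracle classically at `p` and continue with the value `f p`. -/
def QAlg.eval {α : Type} (p : Vec d) (k : ℝ → QAlg d α) : QAlg d α :=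
  .run Unit ⟨.refl ℂ _, [.refl ℂ _]⟩ (p, 0, ()) fun b => k b.2.1

/-- The circuit ends in a basis state, so its measurement is deterministic. -/
theorem QAlg.output_eval {α : Type} (f : Vec d → ℝ) (p : Vec d) (k : ℝ → QAlg d α) :
    (QAlg.eval p k).output f = (k (f p)).output f := by
  have h : (⟨.refl ℂ _, [.refl ℂ _]⟩ : Circuit d Unit).state f (p, 0, ()) = ket (p, f p, ()) := by
    change oracle Unit f (ket (p, 0, ())) = _
    rw [oracle, permUnitary_ket]
    simp
  rw [QAlg.eval, QAlg.output, measure_congr h _ (norm_ket _), measure_ket, PMF.pure_bind]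

theorem QAlg.queriesAtMost_eval {α : Type} {p : Vec d} {k : ℝ → QAlg d α} {n : ℕ}
    (h : ∀ a, (k a).QueriesAtMost n) : (QAlg.eval p k).QueriesAtMost (1 + n) :=
  ⟨n, le_rfl, fun b => h b.2.1⟩

/-- The point at which `f` is queried for the `i`-th forward difference. -/
def probe (x : Vec d) (σ : ℝ) (i : Fin d) : Vec d := x + σ • EuclideanSpace.single i (1 : ℝ)

/-- The signed forward difference of `o`, computed from `f x = y` and the value `a` of `f` at the
probe point. -/
def signedQuotient (σ y : ℝ) (o : SignedIndex d) (a : ℝ) : ℝ := ((o.2 : ℤ) : ℝ) * ((a - y) / σ)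

/-- The forward difference of `f` in the coordinate of `o`, multiplied by the sign of `o`. -/
def signedDiff (f : Vec d → ℝ) (σ : ℝ) (x : Vec d) (o : SignedIndex d) : ℝ :=
  ((o.2 : ℤ) : ℝ) * forwardDiff f σ x o.1

theorem signedQuotient_probe (f : Vec d → ℝ) (σ : ℝ) (x : Vec d) (o : SignedIndex d) :
    signedQuotient σ (f x) o (f (probe x σ o.1)) = signedDiff f σ x o := rfl

/-- The basis label of the item `o`, with answer register `0`. -/
def itemLabel (x : Vec d) (σ : ℝ) (o : SignedIndex d) : Label d (SignedIndex d) :=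
  (probe x σ o.1, 0, o)

/-- The two signs of a coordinate share a probe point; the workspace tells them apart. -/
theorem itemLabel_injective (x : Vec d) (σ : ℝ) : (itemLabel x σ).Injective := by
  intro o o' h
  exact congrArg (fun b => b.2.2) h

/-- Negation of the answer register. -/
def negateAnswer (d : ℕ) (W : Type) : Label d W ≃ Label d W where
  toFun b := (b.1, -b.2.1, b.2.2)
  invFun b := (b.1, -b.2.1, b.2.2)
  left_inv b := by simp
  right_inv b := by simp

theorem oracle_superpose {W ι : Type} [Fintype ι] (f : Vec d → ℝ) (b : ι → Label d W)
    (c : ι → ℂ) : oracle W f (superpose b c) =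
      superpose (fun i => ((b i).1, (b i).2.1 + f (b i).1, (b i).2.2)) c :=
  permUnitary_superpose _ _ _

theorem negateAnswer_superpose {W ι : Type} [Fintype ι] (b : ι → Label d W) (c : ι → ℂ) :
    permUnitary (negateAnswer d W) (superpose b c) =
      superpose (fun i => ((b i).1, -(b i).2.1, (b i).2.2)) c :=
  permUnitary_superpose _ _ _

/-- The labels whose answer register exhibits a signed forward difference above `τ`. -/
def above (σ y τ : ℝ) : Set (Label d (SignedIndex d)) :=
  {b | τ < signedQuotient σ y b.2.2 b.2.1}

/-- The unitaries of `j` Grover iterations. An iteration queries `f`, flips the phase of the labels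
above the threshold, uncomputes the answer by a query between two negations of the answer register,
and applies the diffusion operator. -/
def groverSteps (x : Vec d) (σ y τ : ℝ) :
    ℕ → List (Hilb (Label d (SignedIndex d)) ≃ₗᵢ[ℂ] Hilb (Label d (SignedIndex d)))
  | 0 => []
  | j + 1 => groverSteps x σ y τ j ++
      [(phaseFlip (above σ y τ)).trans (permUnitary (negateAnswer d _)),
        (permUnitary (negateAnswer d _)).trans (diffusion (itemLabel x σ))]

theorem length_groverSteps (x : Vec d) (σ y τ : ℝ) (j : ℕ) :
    (groverSteps x σ y τ j).length = 2 * j := by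
  induction j with
  | zero => rfl
  | succ j ih => simp [groverSteps, ih]; ring

/-- Grover search with `j` iterations for an item with signed forward difference above `τ`. -/
def grover (x : Vec d) (σ y τ : ℝ) (o : SignedIndex d) (j : ℕ) : Circuit d (SignedIndex d) :=
  ⟨prepare (x, 1, o) (itemLabel x σ), groverSteps x σ y τ j⟩

/-- The number of items that are strictly better than `o`. -/
def rank {ι : Type} [Fintype ι] (v : ι → ℝ) (o : ι) : ℕ :=
  (Finset.univ.filter fun o' => v o < v o').card

theorem sum_ite_rank {ι : Type} [Fintype ι] (v : ι → ℝ) (o : ι) (a b : ℝ) :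
    ∑ o', (if v o < v o' then a else b) =
      rank v o * a + (Fintype.card ι - rank v o) * b := by
  have h := Finset.card_filter_add_card_filter_not (s := (Finset.univ : Finset ι))
    (fun o' => v o < v o')
  rw [Finset.sum_ite, Finset.sum_const, Finset.sum_const, nsmul_eq_mul, nsmul_eq_mul, rank]
  rw [Finset.card_univ] at h
  rw [← h]
  push_cast
  ring

/-- The fraction of items that are strictly better than `o`. -/
def betterFraction (f : Vec d → ℝ) (σ : ℝ) (x : Vec d) (o : SignedIndex d) : ℝ :=
  rank (signedDiff f σ x) o / Fintype.card (SignedIndex d)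

/-- The amplitude depends only on whether an item beats `o`, and an iteration preserves this, so the
dynamics reduces to the two-dimensional recursion `groverAmp`. -/
theorem state_grover (f : Vec d → ℝ) (x : Vec d) (σ : ℝ) (o : SignedIndex d) (j : ℕ) :
    (grover x σ (f x) (signedDiff f σ x o) o j).state f (x, 1, o) =
      superpose (itemLabel x σ) fun o' =>
        (((if signedDiff f σ x o < signedDiff f σ x o'
            then (groverAmp (betterFraction f σ x o) j).1
            else (groverAmp (betterFraction f σ x o) j).2) *
          (Real.sqrt (Fintype.card (SignedIndex d)))⁻¹ : ℝ) : ℂ) := by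
  classical
  have : Nonempty (SignedIndex d) := ⟨o⟩
  have hN : (Fintype.card (SignedIndex d) : ℝ) ≠ 0 := by
    have : 0 < Fintype.card (SignedIndex d) := Fintype.card_pos
    positivity
  induction j with
  | zero =>
    -- The initial answer register holds 1, whereas item labels hold 0; this gives the freshness
    -- that `prepare_ket` needs.
    have h : ∀ o', ((x, 1, o) : Label d (SignedIndex d)) ≠ itemLabel x σ o' := by
      intro o' h
      have := congrArg (fun b => b.2.1) h
      simp [itemLabel] at this
    change prepare _ _ (ket _) = _
    rw [prepare_ket (itemLabel_injective x σ) h]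
    simp [groverAmp]
  | succ j ih =>
    have hs : (grover x σ (f x) (signedDiff f σ x o) o (j + 1)).state f (x, 1, o) =
        diffusion (itemLabel x σ) (permUnitary (negateAnswer d _) (oracle _ f
          (permUnitary (negateAnswer d _) (phaseFlip (above σ (f x) (signedDiff f σ x o))
            (oracle _ f ((grover x σ (f x) (signedDiff f σ x o) o j).state f (x, 1, o))))))) := by
      simp [Circuit.state, grover, groverSteps, List.foldl_append]
    rw [hs, ih]
    set a := (groverAmp (betterFraction f σ x o) j).1 with ha
    set b := (groverAmp (betterFraction f σ x o) j).2 with hb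
    set w := (Real.sqrt (Fintype.card (SignedIndex d)))⁻¹ with hw
    set v := signedDiff f σ x with hv
    rw [oracle_superpose, phaseFlip_superpose, negateAnswer_superpose, oracle_superpose,
      negateAnswer_superpose]
    -- A query conjugated by negation of the answer register is the inverse query, so the answer
    -- returns to 0.
    have hlab : (fun o' => ((itemLabel x σ o').1,
        -(-((itemLabel x σ o').2.1 + f (itemLabel x σ o').1) + f (itemLabel x σ o').1),
        (itemLabel x σ o').2.2)) = itemLabel x σ := by
      funext o'
      simp [itemLabel]
    have hmem : ∀ o', (((itemLabel x σ o').1, (itemLabel x σ o').2.1 + f (itemLabel x σ o').1,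
        (itemLabel x σ o').2.2) ∈ above σ (f x) (v o)) ↔ v o < v o' := by
      intro o'
      simp only [above, itemLabel, Set.mem_ofPred_eq, zero_add, signedQuotient_probe, hv]
    simp only [hmem]
    have hflip : ∀ o', (if v o < v o' then -(((if v o < v o' then a else b) * w : ℝ) : ℂ)
        else (((if v o < v o' then a else b) * w : ℝ) : ℂ)) =
          (((if v o < v o' then -a else b) * w : ℝ) : ℂ) := by
      intro o'; split_ifs <;> simp
    simp only [hflip]
    refine (congrArg (fun l => diffusion (itemLabel x σ) (superpose l _)) hlab).trans ?_
    rw [diffusion_superpose (itemLabel_injective x σ)]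
    congr 1
    funext o'
    rw [← Complex.ofReal_sum, ← Finset.sum_mul, sum_ite_rank]
    -- The mean amplitude after the phase flip, as it appears in `groverAmp`.
    have hmean : (rank v o * -a + (Fintype.card (SignedIndex d) - rank v o) * b) * w /
        Fintype.card (SignedIndex d) =
          ((1 - betterFraction f σ x o) * b - betterFraction f σ x o * a) * w := by
      rw [betterFraction, ← hv]
      field_simp
      ring
    have hcast : (((Fintype.card (SignedIndex d) : ℕ) : ℂ)) =
      (((Fintype.card (SignedIndex d) : ℕ) : ℝ) : ℂ) := by simp
    rw [hcast, ← Complex.ofReal_div, hmean]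
    simp only [groverAmp, ← ha, ← hb]
    norm_cast
    split_ifs <;> ring

/-- The bound is per item rather than for the whole marked set: the climb must hit the best of the
marked items, not just any of them. -/
theorem norm_sq_state_grover (f : Vec d → ℝ) (x : Vec d) (σ : ℝ) {o o' : SignedIndex d} (j : ℕ)
    (hj : (2 * j + 1) ^ 2 * rank (signedDiff f σ x) o ≤ Fintype.card (SignedIndex d))
    (ho : signedDiff f σ x o < signedDiff f σ x o') :
    (2 * (j : ℝ) + 1) ^ 2 / (4 * Fintype.card (SignedIndex d)) ≤
      ‖(grover x σ (f x) (signedDiff f σ x o) o j).state f (x, 1, o) (itemLabel x σ o')‖ ^ 2 := by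
  have : Nonempty (SignedIndex d) := ⟨o⟩
  have hN : (0 : ℝ) < Fintype.card (SignedIndex d) := by
    exact_mod_cast (Fintype.card_pos : 0 < Fintype.card (SignedIndex d))
  have hj' : (2 * (j : ℝ) + 1) ^ 2 * betterFraction f σ x o ≤ 1 := by
    rw [betterFraction, ← mul_div_assoc, div_le_one hN]
    exact_mod_cast hj
  have h := (groverAmp_bounds (by unfold betterFraction; positivity) j hj').1
  rw [state_grover, superpose_apply (itemLabel_injective x σ), if_pos ho, Complex.norm_real,
    Real.norm_eq_abs, sq_abs, mul_pow, inv_pow, Real.sq_sqrt hN.le, div_le_iff₀ (by positivity)]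
  have h2 : ((2 * (j : ℝ) + 1) / 2) ^ 2 ≤ (groverAmp (betterFraction f σ x o) j).1 ^ 2 :=
    pow_le_pow_left₀ (by positivity) h 2
  field_simp
  nlinarith

end Circuits

/-! ### Failure probabilities -/

section Prob

variable {α β : Type}

theorem toOuterMeasure_add_compl (p : PMF α) (s : Set α) :
    p.toOuterMeasure s + p.toOuterMeasure sᶜ = 1 := by
  rw [PMF.toOuterMeasure_apply, PMF.toOuterMeasure_apply, ← ENNReal.tsum_add, ← p.tsum_coe]
  refine tsum_congr fun a => ?_
  exact congrFun (Set.indicator_self_add_compl s p) a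

theorem toOuterMeasure_compl_le (p : PMF α) (s : Set α) {r : ℝ} (hr0 : 0 ≤ r) (hr : r ≤ 1)
    (h : ENNReal.ofReal (1 - r) ≤ p.toOuterMeasure s) : p.toOuterMeasure sᶜ ≤ ENNReal.ofReal r := by
  have h1 := toOuterMeasure_add_compl p s
  have h2 : ENNReal.ofReal (1 - r) + p.toOuterMeasure sᶜ ≤ ENNReal.ofReal (1 - r) +
      ENNReal.ofReal r := by
    rw [← ENNReal.ofReal_add (by linarith) hr0, sub_add_cancel, ENNReal.ofReal_one, ← h1]
    gcongr
  exact (ENNReal.add_le_add_iff_left ENNReal.ofReal_ne_top).mp h2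

theorem le_toOuterMeasure (p : PMF α) (s : Set α) {r : ℝ} (hr0 : 0 ≤ r)
    (h : p.toOuterMeasure sᶜ ≤ ENNReal.ofReal r) : ENNReal.ofReal (1 - r) ≤ p.toOuterMeasure s := by
  rw [ENNReal.ofReal_sub _ hr0, ENNReal.ofReal_one, ← toOuterMeasure_add_compl p s]
  exact tsub_le_iff_right.mpr (by gcongr)

/-- If `p` leaves `s` with probability at most `c`, an event of conditional probability at most `η`
on `s` and at most `η + e` elsewhere has probability at most `η + c * e`. -/
theorem toOuterMeasure_bind_le (p : PMF α) (F : α → PMF β) (t : Set β) (s : Set α)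
    {η e c : ℝ≥0∞} (hs : ∀ a ∈ s, (F a).toOuterMeasure t ≤ η)
    (h : ∀ a, (F a).toOuterMeasure t ≤ η + e) (hc : p.toOuterMeasure sᶜ ≤ c) :
    (p.bind F).toOuterMeasure t ≤ η + c * e := by
  rw [PMF.toOuterMeasure_bind_apply]
  calc ∑' a, p a * (F a).toOuterMeasure t
      ≤ ∑' a, (p a * η + sᶜ.indicator p a * e) := by
        refine ENNReal.tsum_le_tsum fun a => ?_
        by_cases ha : a ∈ s
        · rw [Set.indicator_of_notMem (by simpa using ha), zero_mul, add_zero]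
          gcongr
          exact hs a ha
        · rw [Set.indicator_of_mem (by simpa using ha), ← mul_add]
          gcongr
          exact h a
    _ = η + p.toOuterMeasure sᶜ * e := by
        rw [ENNReal.tsum_add, ENNReal.tsum_mul_right, ENNReal.tsum_mul_right, p.tsum_coe, one_mul,
          PMF.toOuterMeasure_apply]
    _ ≤ η + c * e := by gcongr

theorem toOuterMeasure_bind_le_of_forall (p : PMF α) (F : α → PMF β) (t : Set β) {η : ℝ≥0∞}
    (h : ∀ a, (F a).toOuterMeasure t ≤ η) : (p.bind F).toOuterMeasure t ≤ η := by
  have := toOuterMeasure_bind_le p F t Set.univ (η := η) (e := 0) (c := 1) (fun a _ => h a)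
    (fun a => by simpa using h a) (by simp)
  simpa using this

theorem toOuterMeasure_le_one (p : PMF α) (s : Set α) : p.toOuterMeasure s ≤ 1 := by
  rw [← toOuterMeasure_add_compl p s]
  exact le_self_add

end Prob

/-! ### Ranks -/

section Rank

variable {ι : Type} [Fintype ι] {v : ι → ℝ}

theorem rank_anti {o o' : ι} (h : v o ≤ v o') : rank v o' ≤ rank v o :=
  Finset.card_le_card fun _ hx => by
    simp only [Finset.mem_filter, Finset.mem_univ, true_and] at hx ⊢
    exact h.trans_lt hx

theorem lt_of_rank_lt {o o' : ι} (h : rank v o' < rank v o) : v o < v o' := by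
  by_contra h'
  exact absurd (rank_anti (not_lt.mp h')) (not_le.mpr h)

theorem rank_le_card (o : ι) : rank v o ≤ Fintype.card ι := Finset.card_le_univ _

theorem rank_eq_zero_iff {o : ι} : rank v o = 0 ↔ ∀ o', v o' ≤ v o := by
  simp [rank, Finset.filter_eq_empty_iff]

/-- If some item has rank above `N / Q`, at least `N / Q` items have rank at most `N / Q`. -/
theorem card_le_mul_card_rank_le {N Q : ℕ} {o : ι} (ho : N < Q * rank v o) :
    N ≤ Q * (Finset.univ.filter fun o' => Q * rank v o' ≤ N).card := by
  -- Take the best item of rank above N/Q. Its more than N/Q betters all have rank at most N/Q, by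
  -- maximality.
  obtain ⟨x, hx, hmax⟩ := Finset.exists_max_image
    (Finset.univ.filter fun o' => N < Q * rank v o') v ⟨o, by simpa using ho⟩
  simp only [Finset.mem_filter, Finset.mem_univ, true_and] at hx hmax
  refine hx.le.trans (Nat.mul_le_mul_left _ (Finset.card_le_card fun y hy => ?_))
  simp only [Finset.mem_filter, Finset.mem_univ, true_and] at hy ⊢
  by_contra h
  exact absurd (hmax y (not_le.mp h)) (not_le.mpr hy)

end Rank

/-! ### Maximum finding by hill climbing -/

section Climb

variable {d : ℕ}

open Classical in
/-- Hill climbing: for every `j` in the list, run Grover search with `j` iterations for an item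
above the current one, evaluate the outcome, and keep it if it is an improvement. -/
def climb (x : Vec d) (σ y : ℝ) : List ℕ → SignedIndex d → ℝ → QAlg d (SignedIndex d)
  | [], o, _ => .ret o
  | j :: js, o, τ => .run (SignedIndex d) (grover x σ y τ o j) (x, 1, o) fun b =>
      .eval (probe x σ b.2.2.1) fun a =>
        if τ < signedQuotient σ y b.2.2 a then climb x σ y js b.2.2 (signedQuotient σ y b.2.2 a)
        else climb x σ y js o τ

/-- The number of queries made by `climb`. -/
def climbCost (js : List ℕ) : ℕ := (js.map fun j => 2 * j + 1).sum

theorem queriesAtMost_climb (x : Vec d) (σ y : ℝ) (js : List ℕ) (o : SignedIndex d) (τ : ℝ) :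
    (climb x σ y js o τ).QueriesAtMost (climbCost js) := by
  induction js generalizing o τ with
  | nil => trivial
  | cons j js ih =>
    refine ⟨1 + climbCost js, ?_, fun b => QAlg.queriesAtMost_eval fun a => ?_⟩
    · simp only [Circuit.queries, grover, length_groverSteps, climbCost, List.map_cons,
        List.sum_cons]
      omega
    · split_ifs <;> exact ih _ _

open Classical in
/-- The better of two items. -/
def better {ι : Type} (v : ι → ℝ) (o o' : ι) : ι := if v o < v o' then o' else o

theorem rank_better_le {ι : Type} [Fintype ι] (v : ι → ℝ) (o o' : ι) :
    rank v (better v o o') ≤ rank v o := by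
  unfold better
  split_ifs with h
  · exact rank_anti h.le
  · exact le_rfl

variable (f : Vec d → ℝ) (x : Vec d) (σ : ℝ)

/-- The output law of `climb` started at `o`. -/
def climbLaw (js : List ℕ) (o : SignedIndex d) : PMF (SignedIndex d) :=
  (climb x σ (f x) js o (signedDiff f σ x o)).output f

theorem climbLaw_nil (o : SignedIndex d) : climbLaw f x σ [] o = PMF.pure o := rfl

/-- The law of the measured label after Grover search above `o`. -/
def groverLaw (j : ℕ) (o : SignedIndex d) : PMF (Label d (SignedIndex d)) :=
  measure ((grover x σ (f x) (signedDiff f σ x o) o j).state f (x, 1, o)) (Circuit.norm_state _ _ _)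

theorem climbLaw_cons (j : ℕ) (js : List ℕ) (o : SignedIndex d) :
    climbLaw f x σ (j :: js) o =
      (groverLaw f x σ j o).bind fun b => climbLaw f x σ js (better (signedDiff f σ x) o b.2.2) := by
  rw [climbLaw, climb, QAlg.output, groverLaw]
  congr 1
  funext b
  rw [QAlg.output_eval, signedQuotient_probe, better, climbLaw]
  split_ifs <;> rfl

/-- The items that are not maximal. -/
def nonMax : Set (SignedIndex d) := {o | rank (signedDiff f σ x) o ≠ 0}

/-- The set `S` of items meeting the goal of phase k has at least N/9^(k+1) elements, all better
than `o`. Each is measured with probability at least 9^k/(4N), for a total of at least 1/36. -/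
theorem groverLaw_compl_le {k j : ℕ} (hj : 2 * j + 1 = 3 ^ k) {o : SignedIndex d}
    (h₁ : 9 ^ k * rank (signedDiff f σ x) o ≤ Fintype.card (SignedIndex d))
    (h₂ : Fintype.card (SignedIndex d) < 9 ^ (k + 1) * rank (signedDiff f σ x) o) :
    (groverLaw f x σ j o).toOuterMeasure
      {b | 9 ^ (k + 1) * rank (signedDiff f σ x) (better (signedDiff f σ x) o b.2.2) ≤
        Fintype.card (SignedIndex d)}ᶜ ≤ ENNReal.ofReal (35 / 36) := by
  classical
  set v := signedDiff f σ x with hv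
  have : Nonempty (SignedIndex d) := ⟨o⟩
  set N := Fintype.card (SignedIndex d) with hNdef
  have hN : (0 : ℝ) < N := by
    exact_mod_cast (Fintype.card_pos : 0 < Fintype.card (SignedIndex d))
  have hq : (2 * j + 1) ^ 2 = 9 ^ k := by rw [hj, ← pow_mul, mul_comm, pow_mul]; norm_num
  set S := Finset.univ.filter fun o' => 9 ^ (k + 1) * rank v o' ≤ N with hS
  have hcard : N ≤ 9 ^ (k + 1) * S.card := card_le_mul_card_rank_le h₂
  have hSv : ∀ o' ∈ S, v o < v o' := by
    intro o' ho'
    simp only [hS, Finset.mem_filter, Finset.mem_univ, true_and] at ho'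
    exact lt_of_rank_lt (Nat.lt_of_mul_lt_mul_left (ho'.trans_lt h₂))
  refine toOuterMeasure_compl_le _ _ (by norm_num) (by norm_num) ?_
  have hsub : ((S.map ⟨itemLabel x σ, itemLabel_injective x σ⟩ :
      Finset (Label d (SignedIndex d))) : Set (Label d (SignedIndex d))) ⊆
        {b | 9 ^ (k + 1) * rank v (better v o b.2.2) ≤ N} := by
    intro b hb
    obtain ⟨o', ho', rfl⟩ := Finset.mem_map.mp (Finset.mem_coe.mp hb)
    have h := hSv o' ho'
    simp only [hS, Finset.mem_filter, Finset.mem_univ, true_and] at ho'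
    change 9 ^ (k + 1) * rank v (better v o o') ≤ N
    rwa [better, if_pos h]
  refine le_trans ?_ (MeasureTheory.measure_mono (μ := (groverLaw f x σ j o).toOuterMeasure) hsub)
  rw [PMF.toOuterMeasure_apply_finset, Finset.sum_map]
  have hterm : ∀ o' ∈ S, ENNReal.ofReal ((2 * (j : ℝ) + 1) ^ 2 / (4 * N)) ≤
      groverLaw f x σ j o (itemLabel x σ o') := by
    intro o' ho'
    rw [groverLaw, measure_apply]
    exact ENNReal.ofReal_le_ofReal (norm_sq_state_grover f x σ j (by rw [hq]; exact h₁) (hSv o' ho'))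
  refine le_trans ?_ (Finset.sum_le_sum hterm)
  rw [Finset.sum_const, nsmul_eq_mul, ← ENNReal.ofReal_natCast, ← ENNReal.ofReal_mul (by positivity)]
  refine ENNReal.ofReal_le_ofReal ?_
  have hq' : (2 * (j : ℝ) + 1) ^ 2 = 9 ^ k := by exact_mod_cast hq
  have hcard' : (N : ℝ) ≤ 9 ^ k * 9 * S.card := by
    rw [← pow_succ]; exact_mod_cast hcard
  rw [hq', ← mul_div_assoc, le_div_iff₀ (by positivity)]
  linarith

/-- The rank never increases along the climb, so further searches after a goal is met do no harm. -/
theorem climbLaw_append_le_of_forall {k : ℕ} {js rest : List ℕ} {η : ℝ≥0∞}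
    (hrest : ∀ o, k * rank (signedDiff f σ x) o ≤ Fintype.card (SignedIndex d) →
      (climbLaw f x σ rest o).toOuterMeasure (nonMax f x σ) ≤ η) (o : SignedIndex d)
    (ho : k * rank (signedDiff f σ x) o ≤ Fintype.card (SignedIndex d)) :
    (climbLaw f x σ (js ++ rest) o).toOuterMeasure (nonMax f x σ) ≤ η := by
  induction js generalizing o with
  | nil => exact hrest o ho
  | cons j js ih =>
    rw [List.cons_append, climbLaw_cons]
    exact toOuterMeasure_bind_le_of_forall _ _ _ fun b =>
      ih _ ((Nat.mul_le_mul_left _ (rank_better_le _ _ _)).trans ho)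

/-- Each repetition either meets the goal of the phase, after which `rest` fails with probability at
most `η`, or misses it, with probability at most 35/36. -/
theorem climbLaw_replicate_append_le {k j : ℕ} (hj : 2 * j + 1 = 3 ^ k) {rest : List ℕ} {η : ℝ≥0∞}
    (hrest : ∀ o, 9 ^ (k + 1) * rank (signedDiff f σ x) o ≤ Fintype.card (SignedIndex d) →
      (climbLaw f x σ rest o).toOuterMeasure (nonMax f x σ) ≤ η) (n : ℕ) (o : SignedIndex d)
    (ho : 9 ^ k * rank (signedDiff f σ x) o ≤ Fintype.card (SignedIndex d)) :
    (climbLaw f x σ (List.replicate n j ++ rest) o).toOuterMeasure (nonMax f x σ) ≤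
      η + ENNReal.ofReal (35 / 36) ^ n := by
  induction n generalizing o with
  | zero =>
    rw [pow_zero]
    exact (toOuterMeasure_le_one _ _).trans le_add_self
  | succ n ih =>
    by_cases h : 9 ^ (k + 1) * rank (signedDiff f σ x) o ≤ Fintype.card (SignedIndex d)
    · exact (climbLaw_append_le_of_forall f x σ hrest o h).trans le_self_add
    · rw [List.replicate_succ, List.cons_append, climbLaw_cons, pow_succ']
      refine toOuterMeasure_bind_le _ _ _ _ (fun b hb => ?_) (fun b => ?_)
        (groverLaw_compl_le f x σ hj ho (not_le.mp h))
      · exact climbLaw_append_le_of_forall f x σ hrest _ hb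
      · exact ih _ ((Nat.mul_le_mul_left _ (rank_better_le _ _ _)).trans ho)

/-- The iteration counts of the last `i` phases, from phase `k` on: in phase `k` search uses
`(3 ^ k - 1) / 2` iterations and is repeated `i + b` times. -/
def schedule (b : ℕ) : ℕ → ℕ → List ℕ
  | _, 0 => []
  | k, i + 1 => List.replicate (i + 1 + b) ((3 ^ k - 1) / 2) ++ schedule b (k + 1) i

theorem two_mul_iterations_add_one (k : ℕ) : 2 * ((3 ^ k - 1) / 2) + 1 = 3 ^ k := by
  have h : 3 ^ k % 2 = 1 := Nat.odd_iff.mp (Odd.pow (by decide))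
  generalize 3 ^ k = n at h ⊢
  omega

theorem climbLaw_schedule_le (b i k : ℕ) (hk : Fintype.card (SignedIndex d) < 9 ^ (k + i))
    (o : SignedIndex d)
    (ho : 9 ^ k * rank (signedDiff f σ x) o ≤ Fintype.card (SignedIndex d)) :
    (climbLaw f x σ (schedule b k i) o).toOuterMeasure (nonMax f x σ) ≤
      ∑ m ∈ Finset.range i, ENNReal.ofReal (35 / 36) ^ (m + 1 + b) := by
  induction i generalizing k o with
  | zero =>
    -- With no phase left, 9^k · rank ≤ N < 9^k forces rank 0.
    have h0 : rank (signedDiff f σ x) o = 0 := by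
      by_contra h
      have h1 : 9 ^ k * 1 ≤ 9 ^ k * rank (signedDiff f σ x) o :=
        Nat.mul_le_mul_left _ (Nat.one_le_iff_ne_zero.mpr h)
      simp only [add_zero] at hk
      omega
    rw [schedule, climbLaw_nil, PMF.toOuterMeasure_pure_apply, if_neg (by simpa [nonMax] using h0)]
    simp
  | succ i ih =>
    rw [schedule, Finset.sum_range_succ]
    refine climbLaw_replicate_append_le f x σ (two_mul_iterations_add_one k) (fun o' ho' => ?_) _ o ho
    exact ih (k + 1) (by rwa [add_assoc, add_comm 1 i]) o' ho'

/-- The sum of (i - m + b) · 3^(k+m) over m < i. Repetitions decrease linearly while costs triple,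
so no factor i multiplies 3^i. -/
theorem climbCost_schedule (b k i : ℕ) :
    (climbCost (schedule b k i) : ℝ) =
      3 ^ k * ((3 / 4 + b / 2) * (3 ^ i - 1) - i / 2) := by
  induction i generalizing k with
  | zero => simp [schedule, climbCost]
  | succ i ih =>
    have h : climbCost (schedule b k (i + 1)) =
        (i + 1 + b) * 3 ^ k + climbCost (schedule b (k + 1) i) := by
      simp [schedule, climbCost, two_mul_iterations_add_one]
    rw [h]
    push_cast
    rw [ih]
    ring

end Climb

/-! ### The maximum finding subroutine -/

section Finder

variable {d : ℕ}

/-- The number of phases. -/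
def phases (d : ℕ) : ℕ := Nat.log 9 (2 * d) + 1

/-- The number of extra repetitions of each phase that brings the failure probability below `δ`. -/
def repetitions (δ : ℝ) : ℕ := ⌈36 * Real.log (35 / δ)⌉₊

/-- Quantum maximum finding among the signed forward differences. -/
def maxFinder (o : SignedIndex d) : Finder d := fun σ δ x =>
  .eval x fun y => .eval (probe x σ o.1) fun a =>
    climb x σ y (schedule (repetitions δ) 0 (phases d)) o (signedQuotient σ y o a)

theorem card_signedIndex : Fintype.card (SignedIndex d) = 2 * d := by
  rw [Fintype.card_prod, Fintype.card_fin, Fintype.card_units_int, mul_comm]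

theorem sum_pow_repetitions_le {δ : ℝ} (hδ : 0 < δ) (i : ℕ) :
    ∑ m ∈ Finset.range i, ENNReal.ofReal (35 / 36) ^ (m + 1 + repetitions δ) ≤
      ENNReal.ofReal δ := by
  have h : ∀ m, ENNReal.ofReal (35 / 36) ^ (m + 1 + repetitions δ) =
      ENNReal.ofReal ((35 / 36) ^ (m + 1 + repetitions δ)) := fun m =>
    (ENNReal.ofReal_pow (by norm_num) _).symm
  simp only [h]
  rw [← ENNReal.ofReal_sum_of_nonneg fun _ _ => by positivity]
  refine ENNReal.ofReal_le_ofReal ?_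
  -- The divisor 35 pays for the geometric series ∑ (35/36)^(m+1) ≤ 35 over the phases.
  have hb : (35 / 36 : ℝ) ^ repetitions δ ≤ δ / 35 := by
    have h1 : (35 / 36 : ℝ) ≤ Real.exp (-(1 / 36)) := by
      have := Real.add_one_le_exp (-(1 / 36 : ℝ)); linarith
    have h2 : 36 * Real.log (35 / δ) ≤ repetitions δ := Nat.le_ceil _
    calc (35 / 36 : ℝ) ^ repetitions δ ≤ Real.exp (-(1 / 36)) ^ repetitions δ :=
          pow_le_pow_left₀ (by norm_num) h1 _
      _ = Real.exp (-(repetitions δ / 36)) := by rw [← Real.exp_nat_mul]; congr 1; ring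
      _ ≤ Real.exp (-Real.log (35 / δ)) := Real.exp_le_exp.mpr (by linarith)
      _ = δ / 35 := by rw [Real.exp_neg, Real.exp_log (by positivity), inv_div]
  have hsum : ∑ m ∈ Finset.range i, (35 / 36 : ℝ) ^ (m + 1) ≤ 35 := by
    have : ∀ n : ℕ, ∑ m ∈ Finset.range n, (35 / 36 : ℝ) ^ (m + 1) = 35 - 35 * (35 / 36) ^ n := by
      intro n
      induction n with
      | zero => simp
      | succ n ih => rw [Finset.sum_range_succ, ih]; ring
    rw [this]
    have : (0 : ℝ) ≤ (35 / 36) ^ i := by positivity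
    linarith
  calc ∑ m ∈ Finset.range i, (35 / 36 : ℝ) ^ (m + 1 + repetitions δ)
      = (∑ m ∈ Finset.range i, (35 / 36 : ℝ) ^ (m + 1)) * (35 / 36) ^ repetitions δ := by
        rw [Finset.sum_mul]; exact Finset.sum_congr rfl fun m _ => pow_add _ _ _
    _ ≤ 35 * (δ / 35) := by gcongr
    _ = δ := by ring

/-- Since both signs are items, a maximal signed difference is a maximal absolute one. -/
theorem exists_signedDiff_eq_abs (f : Vec d → ℝ) (σ : ℝ) (x : Vec d) (j : Fin d) :
    ∃ s : ℤˣ, signedDiff f σ x (j, s) = |forwardDiff f σ x j| := by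
  rcases abs_choice (forwardDiff f σ x j) with h | h
  · exact ⟨1, by simp [signedDiff, h]⟩
  · exact ⟨-1, by simp [signedDiff, h]⟩

theorem findsMaxAbs_maxFinder (o : SignedIndex d) : (maxFinder o).FindsMaxAbs := by
  intro f σ δ x _ hδ _
  rw [maxFinder, QAlg.output_eval, QAlg.output_eval, signedQuotient_probe]
  refine le_toOuterMeasure _ _ hδ.le ?_
  have hcard : Fintype.card (SignedIndex d) < 9 ^ (0 + phases d) := by
    rw [card_signedIndex, zero_add]
    exact Nat.lt_pow_succ_log_self (by norm_num) _
  refine le_trans (MeasureTheory.measure_mono fun o' ho' => ?_)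
    ((climbLaw_schedule_le f x σ (repetitions δ) (phases d) 0 hcard o
      (by simpa using rank_le_card o)).trans (sum_pow_repetitions_le hδ _))
  intro h0
  refine ho' fun j => ?_
  obtain ⟨s, hs⟩ := exists_signedDiff_eq_abs f σ x j
  rw [← hs]
  exact rank_eq_zero_iff.mp h0 (j, s)

/-- The number of queries of `maxFinder`. -/
def finderCost (d : ℕ) (δ : ℝ) : ℕ := 1 + (1 + climbCost (schedule (repetitions δ) 0 (phases d)))

theorem queriesAtMost_maxFinder (o : SignedIndex d) (σ δ : ℝ) (x : Vec d) :
    (maxFinder o σ δ x).QueriesAtMost (finderCost d δ) :=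
  QAlg.queriesAtMost_eval fun _ => QAlg.queriesAtMost_eval fun _ => queriesAtMost_climb _ _ _ _ _ _

theorem finderCost_le (hd : 0 < d) {δ : ℝ} (hδ : 0 < δ) (hδ1 : δ < 1) :
    (finderCost d δ : ℝ) ≤ Real.sqrt d * (12 + 180 * Real.log (35 / δ)) := by
  have hd1 : (1 : ℝ) ≤ Real.sqrt d := by
    rw [Real.one_le_sqrt]; exact_mod_cast hd
  have hlog : 0 ≤ Real.log (35 / δ) := by
    apply Real.log_nonneg
    rw [le_div_iff₀ hδ]
    linarith
  have hb : (repetitions δ : ℝ) ≤ 36 * Real.log (35 / δ) + 1 :=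
    (Nat.ceil_lt_add_one (by positivity)).le
  -- 9^phases ≤ 18d, and 18 ≤ (9/2)².
  have hK : (3 : ℝ) ^ phases d ≤ 9 / 2 * Real.sqrt d := by
    have h1 : (9 : ℕ) ^ phases d ≤ 9 * (2 * d) := by
      rw [phases, pow_succ']
      exact Nat.mul_le_mul_left _ (Nat.pow_log_le_self 9 (by omega))
    have h2 : ((3 : ℝ) ^ phases d) ^ 2 ≤ 9 * (2 * d) := by
      rw [← pow_mul, mul_comm, pow_mul]
      norm_num
      exact_mod_cast h1
    have h3 : (9 / 2 * Real.sqrt d) ^ 2 = 81 / 4 * d := by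
      rw [mul_pow, Real.sq_sqrt (Nat.cast_nonneg d)]; norm_num
    refine (sq_le_sq₀ (by positivity) (by positivity)).mp ?_
    rw [h3]
    have : (0 : ℝ) ≤ d := Nat.cast_nonneg d
    linarith
  rw [finderCost]
  push_cast
  rw [climbCost_schedule, pow_zero, one_mul]
  set b := (repetitions δ : ℝ)
  set l := Real.log (35 / δ)
  set r := Real.sqrt d
  have hb0 : 0 ≤ b := Nat.cast_nonneg _
  have h4 : (3 / 4 + b / 2) * ((3 : ℝ) ^ phases d - 1) ≤
      (3 / 4 + (36 * l + 1) / 2) * (9 / 2 * r) := by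
    refine mul_le_mul (by linarith) (by linarith) ?_ (by positivity)
    have : (1 : ℝ) ≤ 3 ^ phases d := one_le_pow₀ (by norm_num)
    linarith
  have h5 : (0 : ℝ) ≤ phases d := Nat.cast_nonneg _
  have h6 : 0 ≤ r * l := by positivity
  nlinarith

end Finder

/-! ### Smoothness and curvature -/

section Smooth

variable {d : ℕ} {f : Vec d → ℝ} {L : ℝ}

theorem hasDerivAt_comp_line (hf : Differentiable ℝ f) (x v : Vec d) (t : ℝ) :
    HasDerivAt (fun t : ℝ => f (x + t • v)) (inner ℝ (gradient f (x + t • v)) v) t := by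
  have hline : HasDerivAt (fun t : ℝ => x + t • v) v t := by
    simpa using ((hasDerivAt_id t).smul_const v).const_add x
  exact (hf (x + t • v)).hasGradientAt.hasFDerivAt.comp_hasDerivAt t hline

/-- The two-sided descent lemma: along the segment, the error has derivative at most L‖v‖²t in
absolute value, the derivative of L‖v‖²t²/2. -/
theorem IsSmoothWith.abs_sub_le (hf : IsSmoothWith L f) (x v : Vec d) :
    |f (x + v) - f x - inner ℝ (gradient f x) v| ≤ L / 2 * ‖v‖ ^ 2 := by
  have hder : ∀ t : ℝ, HasDerivAt
      (fun t : ℝ => f (x + t • v) - f x - t * inner ℝ (gradient f x) v)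
      (inner ℝ (gradient f (x + t • v)) v - inner ℝ (gradient f x) v) t := fun t =>
    ((hasDerivAt_comp_line hf.1 x v t).sub_const (f x)).sub (hasDerivAt_mul_const _)
  have hB : ∀ t : ℝ, HasDerivAt (fun t : ℝ => L / 2 * ‖v‖ ^ 2 * t ^ 2) (L * ‖v‖ ^ 2 * t) t :=
    fun t => ((hasDerivAt_pow 2 t).const_mul (L / 2 * ‖v‖ ^ 2)).congr_deriv (by
      push_cast; ring)
  have key := image_norm_le_of_norm_deriv_right_le_deriv_boundary (a := 0) (b := 1)
    (fun t _ => (hder t).continuousAt.continuousWithinAt)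
    (fun t _ => (hder t).hasDerivWithinAt) (by simp) hB (fun t ht => ?_)
    (Set.right_mem_Icc.mpr zero_le_one)
  · simpa using key
  · rw [← inner_sub_left]
    refine (norm_inner_le_norm _ _).trans ?_
    have h := hf.2 (x + t • v) x
    rw [add_sub_cancel_left, norm_smul, Real.norm_eq_abs, abs_of_nonneg ht.1] at h
    calc ‖gradient f (x + t • v) - gradient f x‖ * ‖v‖ ≤ L * (t * ‖v‖) * ‖v‖ := by gcongr
      _ = L * ‖v‖ ^ 2 * t := by ring

theorem IsSmoothWith.nonneg (hf : IsSmoothWith L f) (hd : 0 < d) : 0 ≤ L := by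
  have h := hf.2 (EuclideanSpace.single ⟨0, hd⟩ 1) 0
  have h' := (norm_nonneg _).trans h
  simpa using h'

theorem IsSmoothWith.abs_forwardDiff_sub_le (hf : IsSmoothWith L f) {σ : ℝ} (hσ : 0 < σ)
    (x : Vec d) (i : Fin d) : |forwardDiff f σ x i - gradient f x i| ≤ L * σ / 2 := by
  have h := hf.abs_sub_le x (σ • EuclideanSpace.single i (1 : ℝ))
  rw [inner_smul_right, EuclideanSpace.inner_single_right, norm_smul, Real.norm_eq_abs,
    abs_of_pos hσ] at h
  have e : forwardDiff f σ x i - gradient f x i =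
      (f (x + σ • EuclideanSpace.single i (1 : ℝ)) - f x - σ * gradient f x i) / σ := by
    rw [forwardDiff]; field_simp
  rw [e, abs_div, abs_of_pos hσ, div_le_iff₀ hσ]
  simp only [conj_trivial, one_mul, PiLp.norm_single, norm_one, mul_one] at h
  linarith

theorem norm_le_one_of_mem_l1Ball {x : Vec d} (hx : x ∈ l1Ball d) : ‖x‖ ≤ 1 := by
  have h : ‖x‖ ^ 2 ≤ 1 ^ 2 := by
    rw [EuclideanSpace.norm_sq_eq]
    calc ∑ i, ‖x i‖ ^ 2 ≤ (∑ i, ‖x i‖) ^ 2 :=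
          Finset.sum_sq_le_sq_sum_of_nonneg fun i _ => norm_nonneg _
      _ ≤ 1 ^ 2 := pow_le_pow_left₀ (by positivity) hx 2
  exact (sq_le_sq₀ (norm_nonneg _) zero_le_one).mp h

/-- The ball has diameter at most 2, which gives L · 2². This makes the supremum defining the
curvature a genuine one, and forces L > 0 when C_f > 0. -/
theorem IsSmoothWith.linear_approx_le (hf : IsSmoothWith L f) (hd : 0 < d) {x s : Vec d}
    (hx : x ∈ l1Ball d) (hs : s ∈ l1Ball d) {β : ℝ} (hβ : β ∈ Set.Ioc (0 : ℝ) 1) :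
    2 / β ^ 2 * (f (x + β • (s - x)) - f x
      - inner ℝ ((x + β • (s - x)) - x) (gradient f x)) ≤ 4 * L := by
  have hβ0 := hβ.1
  have h := (abs_le.mp (hf.abs_sub_le x (β • (s - x)))).2
  rw [add_sub_cancel_left, real_inner_comm, div_mul_eq_mul_div, div_le_iff₀ (by positivity)]
  rw [norm_smul, Real.norm_eq_abs, abs_of_pos hβ0, mul_pow] at h
  have hn : ‖s - x‖ ^ 2 ≤ 2 ^ 2 := by
    refine pow_le_pow_left₀ (norm_nonneg _) ((norm_sub_le _ _).trans ?_) 2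
    linarith [norm_le_one_of_mem_l1Ball hx, norm_le_one_of_mem_l1Ball hs]
  have hL := hf.nonneg hd
  have h2 : L * β ^ 2 * ‖s - x‖ ^ 2 ≤ L * β ^ 2 * 2 ^ 2 := by gcongr
  nlinarith

theorem IsSmoothWith.le_curvature (hf : IsSmoothWith L f) (hd : 0 < d) {x s : Vec d}
    (hx : x ∈ l1Ball d) (hs : s ∈ l1Ball d) {β : ℝ} (hβ : β ∈ Set.Ioc (0 : ℝ) 1) :
    f (x + β • (s - x)) ≤ f x + β * inner ℝ (s - x) (gradient f x)
      + β ^ 2 / 2 * curvature (l1Ball d) f := by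
  have hb : 2 / β ^ 2 * (f (x + β • (s - x)) - f x
      - inner ℝ ((x + β • (s - x)) - x) (gradient f x)) ≤ curvature (l1Ball d) f := by
    -- Boundedness is essential: `sSup` of an unbounded set of reals is 0.
    refine le_csSup ⟨4 * L, ?_⟩ ⟨x, hx, s, hs, β, hβ, rfl⟩
    rintro c ⟨x', hx', s', hs', β', hβ', rfl⟩
    exact hf.linear_approx_le hd hx' hs' hβ'
  have hβ0 := hβ.1
  rw [add_sub_cancel_left, real_inner_smul_left, div_mul_eq_mul_div,
    div_le_iff₀ (by positivity)] at hb
  linarith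

theorem IsSmoothWith.pos_of_curvature_pos (hf : IsSmoothWith L f) (hd : 0 < d)
    (hc : 0 < curvature (l1Ball d) f) : 0 < L := by
  refine lt_of_le_of_ne (hf.nonneg hd) fun h0 => absurd hc (not_lt.mpr ?_)
  refine Real.sSup_nonpos ?_
  rintro c ⟨x, hx, s, hs, β, hβ, rfl⟩
  have := hf.linear_approx_le hd hx hs hβ
  rwa [← h0, mul_zero] at this

end Smooth

/-! ### Frank-Wolfe steps -/

section FrankWolfe

variable {d : ℕ} {f : Vec d → ℝ} {L : ℝ}

theorem convex_l1Ball : Convex ℝ (l1Ball d) := by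
  intro x hx y hy a b ha hb hab
  change ∑ i, |a * x i + b * y i| ≤ 1
  have hx' : ∑ i, |x i| ≤ 1 := hx
  have hy' : ∑ i, |y i| ≤ 1 := hy
  calc ∑ i, |a * x i + b * y i| ≤ ∑ i, (a * |x i| + b * |y i|) := by
        refine Finset.sum_le_sum fun i _ => (abs_add_le _ _).trans ?_
        rw [abs_mul, abs_mul, abs_of_nonneg ha, abs_of_nonneg hb]
    _ = a * ∑ i, |x i| + b * ∑ i, |y i| := by
        rw [Finset.sum_add_distrib, Finset.mul_sum, Finset.mul_sum]
    _ ≤ a * 1 + b * 1 := by gcongr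
    _ = 1 := by linarith

theorem abs_coe_units (s : ℤˣ) : |((s : ℤ) : ℝ)| = 1 := by
  rcases Int.units_eq_one_or s with h | h <;> simp [h]

theorem atom_mem_l1Ball (o : SignedIndex d) : atom o ∈ l1Ball d := by
  change ∑ i, |(-((o.2 : ℤ) : ℝ)) * (EuclideanSpace.single o.1 (1 : ℝ) : Vec d) i| ≤ 1
  simp [abs_coe_units, apply_ite abs]

/-- Hölder's inequality for the pair ℓ₁, ℓ∞. -/
theorem neg_le_inner_of_mem_l1Ball {x g : Vec d} {M : ℝ} (hM : 0 ≤ M) (hx : x ∈ l1Ball d)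
    (hg : ∀ i, |g i| ≤ M) : -M ≤ inner ℝ x g := by
  have h : |inner ℝ x g| ≤ M := by
    rw [PiLp.inner_apply]
    calc |∑ i, inner ℝ (x i) (g i)| ≤ ∑ i, |inner ℝ (x i) (g i)| :=
          Finset.abs_sum_le_sum_abs _ _
      _ ≤ ∑ i, |x i| * M := Finset.sum_le_sum fun i _ => by
          have : inner ℝ (x i) (g i) = g i * x i := rfl
          rw [this, abs_mul, mul_comm]
          exact mul_le_mul_of_nonneg_left (hg i) (abs_nonneg _)
      _ = (∑ i, |x i|) * M := (Finset.sum_mul _ _ _).symm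
      _ ≤ 1 * M := mul_le_mul_of_nonneg_right hx hM
      _ = M := one_mul M
  exact (abs_le.mp h).1

/-- The atom of a maximal forward difference nearly minimises the linearisation of `f`. -/
theorem IsSmoothWith.inner_atom_le (hf : IsSmoothWith L f) {σ : ℝ} (hσ : 0 < σ) {x y : Vec d}
    (hy : y ∈ l1Ball d) {o : SignedIndex d}
    (ho : ∀ j, |forwardDiff f σ x j| ≤ ((o.2 : ℤ) : ℝ) * forwardDiff f σ x o.1) :
    inner ℝ (atom o) (gradient f x) ≤ inner ℝ y (gradient f x) + L * σ := by
  have hfd := hf.abs_forwardDiff_sub_le hσ x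
  have hin : inner ℝ (atom o) (gradient f x) = -(((o.2 : ℤ) : ℝ) * gradient f x o.1) := by
    rw [atom, real_inner_smul_left, EuclideanSpace.inner_single_left]
    simp
  have hs : |((o.2 : ℤ) : ℝ) * forwardDiff f σ x o.1 - ((o.2 : ℤ) : ℝ) * gradient f x o.1| ≤
      L * σ / 2 := by
    rw [← mul_sub, abs_mul, abs_coe_units, one_mul]
    exact hfd o.1
  -- The error Lσ/2 enters twice: at the coordinate j and at the selected one.
  have hg : ∀ j, |gradient f x j| ≤ ((o.2 : ℤ) : ℝ) * gradient f x o.1 + L * σ := by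
    intro j
    have h1 := abs_sub_abs_le_abs_sub (gradient f x j) (forwardDiff f σ x j)
    rw [abs_sub_comm] at h1
    linarith [hfd j, ho j, (abs_le.mp hs).2]
  have h := neg_le_inner_of_mem_l1Ball ((abs_nonneg _).trans (hg o.1)) hy hg
  rw [hin]
  linarith

theorem inner_gradient_le_of_convexOn {x y : Vec d} (hc : ConvexOn ℝ Set.univ f)
    (hf : Differentiable ℝ f) : inner ℝ (y - x) (gradient f x) ≤ f y - f x := by
  have hder : HasDerivAt (fun t : ℝ => f (x + t • (y - x)))
      (inner ℝ (y - x) (gradient f x)) 0 :=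
    (hasDerivAt_comp_line hf x (y - x) 0).congr_deriv (by
      rw [zero_smul, add_zero, real_inner_comm])
  have hconv : ConvexOn ℝ Set.univ fun t : ℝ => f (x + t • (y - x)) := by
    have h := hc.comp_affineMap (AffineMap.lineMap x y : ℝ →ᵃ[ℝ] Vec d)
    rw [Set.preimage_univ] at h
    refine h.congr fun t _ => ?_
    rw [Function.comp_apply, AffineMap.lineMap_apply, vsub_eq_sub, vadd_eq_add, add_comm]
  have h := hconv.le_slope_of_hasDerivAt (Set.mem_univ 0) (Set.mem_univ 1) zero_lt_one hder
  simpa [slope] using h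

/-- One Frank-Wolfe step with a linear minimisation oracle of accuracy `C_f / (t + 2)`. -/
theorem frankWolfe_step (hd : 0 < d) (hc : ConvexOn ℝ Set.univ f) (hf : IsSmoothWith L f)
    (hCf : 0 < curvature (l1Ball d) f) (t : ℕ) {x y : Vec d} (hx : x ∈ l1Ball d)
    (hy : y ∈ l1Ball d)
    (hxy : 1 ≤ t → f x - f y ≤ 4 * curvature (l1Ball d) f / ((t : ℝ) + 2)) {o : SignedIndex d}
    (ho : ∀ j, |forwardDiff f (stepSize d (curvature (l1Ball d) f) L t) x j| ≤
      ((o.2 : ℤ) : ℝ) * forwardDiff f (stepSize d (curvature (l1Ball d) f) L t) x o.1) :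
    f ((1 - 2 / ((t : ℝ) + 2)) • x + (2 / ((t : ℝ) + 2)) • atom o) - f y ≤
      4 * curvature (l1Ball d) f / ((t : ℝ) + 1 + 2) := by
  set c := curvature (l1Ball d) f with hcdef
  have hL := hf.pos_of_curvature_pos hd hCf
  have ht : (0 : ℝ) ≤ t := Nat.cast_nonneg t
  have hsd : 1 ≤ Real.sqrt d := by rw [Real.one_le_sqrt]; exact_mod_cast hd
  have hσ : 0 < stepSize d c L t := by unfold stepSize; positivity
  -- This is the accuracy that the step size is designed for; the factor 1/√d only makes it smaller.
  have hLσ : L * stepSize d c L t ≤ c / ((t : ℝ) + 2) := by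
    have : L * stepSize d c L t = c / ((t : ℝ) + 2) / Real.sqrt d := by
      unfold stepSize; field_simp
    rw [this]
    exact div_le_self (by positivity) hsd
  have h1 := hf.inner_atom_le hσ hy ho
  have h2 := inner_gradient_le_of_convexOn (x := x) (y := y) hc hf.1
  have hγ : (2 / ((t : ℝ) + 2)) ∈ Set.Ioc (0 : ℝ) 1 :=
    ⟨by positivity, (div_le_one (by positivity)).mpr (by linarith)⟩
  have h3 := hf.le_curvature hd hx (atom_mem_l1Ball o) hγ
  have e : (1 - 2 / ((t : ℝ) + 2)) • x + (2 / ((t : ℝ) + 2)) • atom o =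
      x + (2 / ((t : ℝ) + 2)) • (atom o - x) := by module
  rw [e]
  rw [inner_sub_left] at h2 h3
  have h4 : inner ℝ (atom o) (gradient f x) - inner ℝ x (gradient f x) ≤
      -(f x - f y) + c / ((t : ℝ) + 2) := by linarith
  have h5 := mul_le_mul_of_nonneg_left h4 hγ.1.le
  -- At t = 0 the old gap has weight 0, so nothing need be known about the starting point; hence the
  -- guard `1 ≤ t`.
  have h6 : (1 - 2 / ((t : ℝ) + 2)) * (f x - f y) ≤ 4 * c * t / ((t : ℝ) + 2) ^ 2 := by
    rcases Nat.eq_zero_or_pos t with h0 | h0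
    · subst h0; simp
    · have h7 : 1 - 2 / ((t : ℝ) + 2) = t / ((t : ℝ) + 2) := by field_simp; ring
      rw [h7]
      refine (mul_le_mul_of_nonneg_left (hxy h0) (by positivity)).trans (le_of_eq ?_)
      field_simp
  have h8 : f (x + (2 / ((t : ℝ) + 2)) • (atom o - x)) - f y ≤
      4 * c * t / ((t : ℝ) + 2) ^ 2 + 4 * c / ((t : ℝ) + 2) ^ 2 := by
    have h9 : 2 / ((t : ℝ) + 2) * (c / ((t : ℝ) + 2)) + (2 / ((t : ℝ) + 2)) ^ 2 / 2 * c =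
        4 * c / ((t : ℝ) + 2) ^ 2 := by field_simp; ring
    rw [← hcdef] at h3
    linarith
  refine h8.trans ?_
  -- What remains is (t+1)(t+3) ≤ (t+2)².
  rw [← add_div, div_le_div_iff₀ (by positivity) (by positivity)]
  nlinarith

/-- The iterates that satisfy the Frank-Wolfe guarantee after `t` rounds. -/
def goodIterates (f : Vec d → ℝ) (y : Vec d) (t : ℕ) : Set (Vec d) :=
  {x | x ∈ l1Ball d ∧ (1 ≤ t → f x - f y ≤ 4 * curvature (l1Ball d) f / ((t : ℝ) + 2))}

/-- Union bound: a round started at a good iterate spoils it only if the subroutine fails, and the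
bad iterates so far are charged in full (`e = 1`). -/
theorem quantumFW_compl_le (hd : 0 < d) {A : Finder d} (hA : A.FindsMaxAbs)
    (hc : ConvexOn ℝ Set.univ f) (hf : IsSmoothWith L f) (hCf : 0 < curvature (l1Ball d) f)
    {δ : ℝ} (hδ : 0 < δ) (hδ1 : δ < 1) {x₀ y : Vec d} (hx₀ : x₀ ∈ l1Ball d) (hy : y ∈ l1Ball d)
    (t : ℕ) :
    (quantumFW A f (stepSize d (curvature (l1Ball d) f) L) δ x₀ t).toOuterMeasure
      (goodIterates f y t)ᶜ ≤ t * ENNReal.ofReal δ := by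
  induction t with
  | zero =>
    have : x₀ ∈ goodIterates f y 0 := ⟨hx₀, fun h => absurd h (by norm_num)⟩
    rw [quantumFW, PMF.toOuterMeasure_pure_apply, if_neg (by simpa using this)]
    simp
  | succ t ih =>
    set p := quantumFW A f (stepSize d (curvature (l1Ball d) f) L) δ x₀ t
    have h := toOuterMeasure_bind_le p (fun x =>
        ((A (stepSize d (curvature (l1Ball d) f) L t) δ x).output f).map fun o =>
          (1 - 2 / ((t : ℝ) + 2)) • x + (2 / ((t : ℝ) + 2)) • atom o)
      (goodIterates f y (t + 1))ᶜ (goodIterates f y t) (η := ENNReal.ofReal δ) (e := 1)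
      (fun x hx => ?_) (fun x => (toOuterMeasure_le_one _ _).trans le_add_self) ih
    · rw [quantumFW]
      refine h.trans (le_of_eq ?_)
      push_cast
      ring
    · have hL := hf.pos_of_curvature_pos hd hCf
      have hσ : 0 < stepSize d (curvature (l1Ball d) f) L t := by
        have : (0 : ℝ) < d := by exact_mod_cast hd
        unfold stepSize; positivity
      rw [PMF.toOuterMeasure_map_apply]
      refine le_trans (MeasureTheory.measure_mono (Set.compl_subset_compl.mpr fun o hgood => ?_))
        (toOuterMeasure_compl_le _ _ hδ.le hδ1.le (hA f _ δ x hσ hδ hδ1))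
      have ht : (0 : ℝ) ≤ t := Nat.cast_nonneg t
      have hγ : 2 / ((t : ℝ) + 2) ≤ 1 := (div_le_one (by positivity)).mpr (by linarith)
      refine ⟨convex_l1Ball hx.1 (atom_mem_l1Ball o) (by linarith) (by positivity) (by ring),
        fun _ => ?_⟩
      push_cast
      exact frankWolfe_step hd hc hf hCf t hx.1 hy hx.2 hgood

end FrankWolfe

/-! ### The number of rounds -/

section Rounds

variable {c ε : ℝ}

theorem one_le_rounds : 1 ≤ rounds c ε := le_max_left _ _

theorem div_rounds_le (hε : 0 < ε) : 4 * c / ((rounds c ε : ℝ) + 2) ≤ ε := by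
  have h : 4 * c / ε - 2 ≤ rounds c ε :=
    (Nat.le_ceil _).trans (by exact_mod_cast le_max_right _ _)
  rw [div_le_iff₀ (by positivity)]
  have h' : 4 * c / ε ≤ rounds c ε + 2 := by linarith
  rw [div_le_iff₀ hε] at h'
  linarith

theorem rounds_le : (rounds c ε : ℝ) ≤ 4 * max 1 (c / ε) := by
  have h1 : (1 : ℝ) ≤ max 1 (c / ε) := le_max_left _ _
  rw [rounds, Nat.cast_max, Nat.cast_one]
  refine max_le (by linarith) ?_
  rcases le_or_gt (4 * c / ε - 2) 0 with h | h
  · rw [Nat.ceil_eq_zero.mpr h]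
    simp only [Nat.cast_zero]
    linarith
  · have h2 := Nat.ceil_lt_add_one h.le
    have h3 : 4 * c / ε = 4 * (c / ε) := by ring
    linarith [le_max_right 1 (c / ε)]

/-- The number of rounds is at most 4 max(1, C_f/ε), so dividing p among them adds only a constant
to the logarithm: 35 · 4 = 140 ≤ e⁵. -/
theorem log_div_rounds_le {p : ℝ} (hp : 0 < p) :
    Real.log (35 / (p / (rounds c ε : ℕ))) ≤ 5 + Real.log (max 1 (c / ε) / p) := by
  have hM : (0 : ℝ) < max 1 (c / ε) := lt_max_of_lt_left zero_lt_one
  have hT : (0 : ℝ) < rounds c ε := by exact_mod_cast one_le_rounds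
  have h5 : (140 : ℝ) ≤ Real.exp 5 := by
    have h := Real.exp_one_gt_d9
    have e : Real.exp 5 = Real.exp 1 ^ 5 := by rw [← Real.exp_nat_mul]; norm_num
    rw [e]
    calc (140 : ℝ) ≤ 2.7 ^ 5 := by norm_num
      _ ≤ Real.exp 1 ^ 5 := pow_le_pow_left₀ (by norm_num) (by linarith) 5
  rw [Real.log_le_iff_le_exp (by positivity), Real.exp_add, Real.exp_log (by positivity)]
  calc 35 / (p / (rounds c ε : ℕ)) = 35 * (rounds c ε : ℝ) / p := by field_simp
    _ ≤ 35 * (4 * max 1 (c / ε)) / p := by gcongr; exact rounds_le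
    _ = 140 * (max 1 (c / ε) / p) := by ring
    _ ≤ Real.exp 5 * (max 1 (c / ε) / p) := by gcongr

end Rounds

end QFW

end

theorem theorem1 :
    ∃ C : ℝ, 0 < C ∧ ∀ d : ℕ, 0 < d →
      ∃ A : QFW.Finder d, A.FindsMaxAbs ∧
        ∀ (f : QFW.Vec d → ℝ) (L Cf : ℝ),
          ConvexOn ℝ Set.univ f → QFW.IsSmoothWith L f →
          Cf = QFW.curvature (QFW.l1Ball d) f → 0 < Cf →
          ∀ (ε p : ℝ), 0 < ε → 0 < p → p < 1 →
          ∀ T : ℕ, T = QFW.rounds Cf ε →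
            (∀ x₀ ∈ QFW.l1Ball d, ∀ xstar ∈ QFW.l1Ball d, IsMinOn f (QFW.l1Ball d) xstar →
              ENNReal.ofReal (1 - p) ≤
                (QFW.quantumFW A f (QFW.stepSize d Cf L) (p / T) x₀ T).toOuterMeasure
                  {x | x ∈ QFW.l1Ball d ∧ f x - f xstar ≤ ε}) ∧
            (∀ t < T, ∀ x : QFW.Vec d, ∃ N : ℕ,
              (A (QFW.stepSize d Cf L t) (p / T) x).QueriesAtMost N ∧
              (N : ℝ) ≤ C * (Real.sqrt d * (1 + Real.log (max 1 (Cf / ε) / p)))) := by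
  -- The constant: 12 + 180(5 + ℓ) ≤ 1000(1 + ℓ) for ℓ ≥ 0. The climb may start at any item;
  -- coordinate 0 exists because d > 0.
  refine ⟨1000, by norm_num, fun d hd => ⟨QFW.maxFinder (⟨0, hd⟩, 1),
    QFW.findsMaxAbs_maxFinder _, ?_⟩⟩
  rintro f L Cf hc hf rfl hCf ε p hε hp hp1 T rfl
  set c := QFW.curvature (QFW.l1Ball d) f with hcdef
  have hT1 : (1 : ℝ) ≤ QFW.rounds c ε := by exact_mod_cast QFW.one_le_rounds
  have hδ : 0 < p / QFW.rounds c ε := by positivity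
  have hδ1 : p / QFW.rounds c ε < 1 := (div_le_self hp.le hT1).trans_lt hp1
  refine ⟨fun x₀ hx₀ y hy _ => ?_, fun t _ x =>
    ⟨QFW.finderCost d (p / QFW.rounds c ε), QFW.queriesAtMost_maxFinder _ _ _ _, ?_⟩⟩
  · refine QFW.le_toOuterMeasure _ _ hp.le (le_trans (MeasureTheory.measure_mono ?_)
      ((QFW.quantumFW_compl_le hd (QFW.findsMaxAbs_maxFinder _) hc hf hCf hδ hδ1 hx₀ hy _).trans ?_))
    · refine Set.compl_subset_compl.mpr fun x hx => ⟨hx.1, ?_⟩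
      exact (hx.2 QFW.one_le_rounds).trans (QFW.div_rounds_le hε)
    · rw [← ENNReal.ofReal_natCast, ← ENNReal.ofReal_mul (by positivity),
        mul_div_cancel₀ _ (by positivity)]
  · refine (QFW.finderCost_le hd hδ hδ1).trans ?_
    have hlog := QFW.log_div_rounds_le (c := c) (ε := ε) hp
    have hl : 0 ≤ Real.log (max 1 (c / ε) / p) :=
      Real.log_nonneg ((one_le_div hp).mpr (hp1.le.trans (le_max_left _ _)))
    have hs := Real.sqrt_nonneg (d : ℝ)
    calc Real.sqrt d * (12 + 180 * Real.log (35 / (p / QFW.rounds c ε)))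
        ≤ Real.sqrt d * (1000 * (1 + Real.log (max 1 (c / ε) / p))) :=
          mul_le_mul_of_nonneg_left (by linarith) hs
      _ = 1000 * (Real.sqrt d * (1 + Real.log (max 1 (c / ε) / p))) := by ring
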